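/- Let $n\ge 1$, let $\mathbb B$ be the open unit ball of $\mathbb C^n$ with its Hermitian norm $|\cdot|$, let $\sigma$ be the normalized surface measure on the unit sphere $\partial\mathbb B$, and let $0<p\le\infty$. For $p<\infty$, $H^p(\mathbb B)$ is the space of holomorphic functions $f$ on $\mathbb B$ with $$\|f\|_p:=\Big(\sup_{0\le r<1}\int_{\partial\mathbb B}|f(r\zeta)|^p\,d\sigma(\zeta)\Big)^{1/p}<\infty,$$ and $H^\infty(\mathbb B)$ is the space of bounded holomorphic functions on $\mathbb B$ with $\|f\|_\infty:=\sup_{\mathbb B}|f|$. For a sequence $S=\{a_k\}_{k\in\mathbb N}$ of points of $\mathbb B$, let $\ell^p_H(S)$ be the space of complex sequences $\lambda=\{\lambda_k\}_{k\in\mathbb N}$ with $$\|\lambda\|_{H,p}:=\Big(\sum_{k\in\mathbb N}|\lambda_k|^p(1-|a_k|^2)^n\Big)^{1/p}<\infty$$ (for $p=\infty$: $\|\lambda\|_{H,\infty}:=\sup_k|\lambda_k|<\infty$). The sequence $S$ is called interpolating for $H^p(\mathbb B)$ with constant $C\ge 0$ if for every $\lambda\in\ell^p_H(S)$ there is $f\in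 H^p(\mathbb B)$ with $f(a_k)=\lambda_k$ for all $k\in\mathbb N$ and $\|f\|_p\le C\|\lambda\|_{H,p}$. Theorem. If $S=\{a_k\}_{k\in\mathbb N}\subset\mathbb B$ is interpolating for $H^p(\mathbb B)$ with constant $C$ and $\Phi$ is an automorphism of $\mathbb B$ (a biholomorphic map of $\mathbb B$ onto itself), then the sequence $\Phi(S)=\{\Phi(a_k)\}_{k\in\mathbb N}\subset\mathbb B$ is also interpolating for $H^p(\mathbb B)$ with the same constant $C$. -/

import Mathlib

open MeasureTheory
open scoped ENNReal NNReal

noncomputable section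

/-- The Hermitian space `ℂⁿ`. -/
abbrev Cn (n : ℕ) : Type := EuclideanSpace ℂ (Fin n)

/-- The open unit ball `𝔹` of `ℂⁿ`. -/
def unitBall (n : ℕ) : Set (Cn n) := Metric.ball 0 1

/-- The surface (Lebesgue) measure of the unit sphere `∂𝔹` of `ℂⁿ = ℝ²ⁿ`, normalized to have
total mass one. -/
def sphereMeasure (n : ℕ) : Measure (Metric.sphere (0 : Cn n) 1) :=
  ((volume : Measure (Cn n)).toSphere Set.univ)⁻¹ • (volume : Measure (Cn n)).toSphere

/-- The Hardy norm of `f : 𝔹 → ℂ` (only the values of `f` on `𝔹` matter):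
`(sup_{0 ≤ r < 1} ∫_{∂𝔹} |f (r ζ)|^p dσ(ζ))^(1/p)` for finite `p`, and `sup_𝔹 |f|` for `p = ∞`. -/
def hardyNorm (n : ℕ) (p : ℝ≥0∞) (f : Cn n → ℂ) : ℝ≥0∞ :=
  if p = ∞ then ⨆ z ∈ unitBall n, ‖f z‖ₑ
  else (⨆ r ∈ Set.Ico (0 : ℝ) 1,
    ∫⁻ ζ, ‖f ((r : ℂ) • (ζ : Cn n))‖ₑ ^ p.toReal ∂(sphereMeasure n)) ^ (1 / p.toReal)

/-- `f ∈ H^p(𝔹)`: `f` is holomorphic on `𝔹` and has finite Hardy norm. -/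
def MemHardy (n : ℕ) (p : ℝ≥0∞) (f : Cn n → ℂ) : Prop :=
  DifferentiableOn ℂ f (unitBall n) ∧ hardyNorm n p f < ∞

/-- The norm of `ℓ^p_H(S)` for a sequence `S = {a_k}` in `𝔹`:
`(∑ |lam_k|^p (1 - |a_k|²)^n)^(1/p)` for finite `p`, and `sup_k |lam_k|` for `p = ∞`. -/
def seqNorm (n : ℕ) (p : ℝ≥0∞) (a : ℕ → Cn n) (lam : ℕ → ℂ) : ℝ≥0∞ :=
  if p = ∞ then ⨆ k, ‖lam k‖ₑ
  else (∑' k, ‖lam k‖ₑ ^ p.toReal * ENNReal.ofReal ((1 - ‖a k‖ ^ 2) ^ n)) ^ (1 / p.toReal)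

/-- The sequence `S = {a_k}` of points of `𝔹` is interpolating for `H^p(𝔹)` with constant `C`. -/
def IsHardyInterpolating (n : ℕ) (p : ℝ≥0∞) (a : ℕ → Cn n) (C : ℝ≥0) : Prop :=
  (∀ k, a k ∈ unitBall n) ∧
    ∀ lam : ℕ → ℂ, seqNorm n p a lam < ∞ →
      ∃ f : Cn n → ℂ, MemHardy n p f ∧ (∀ k, f (a k) = lam k) ∧
        hardyNorm n p f ≤ C * seqNorm n p a lam

/-- `Φ` restricts to an automorphism of `𝔹`, that is, to a biholomorphic map of `𝔹` onto `𝔹`. -/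
def IsBallAutomorphism (n : ℕ) (Φ : Cn n → Cn n) : Prop :=
  DifferentiableOn ℂ Φ (unitBall n) ∧ Set.MapsTo Φ (unitBall n) (unitBall n) ∧
    ∃ Ψ : Cn n → Cn n, DifferentiableOn ℂ Ψ (unitBall n) ∧
      Set.MapsTo Ψ (unitBall n) (unitBall n) ∧ Set.InvOn Ψ Φ (unitBall n) (unitBall n)

end

/-! Let `Ψ` be the inverse of `Φ` and `c = Φ 0`. By Cartan's theorem `Ψ` is the involution
exchanging `0` and `c`, followed by a linear isometry. Hence `1 - |Ψ z|² = K(z) (1 - |z|²)` on the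
ball, where `K = ballKernel c`. For finite `p` the holomorphic factor `ballFactor` satisfies
`|ballFactor|^p = K^n`. Dividing the data by its values at the points `Φ (a k)` therefore turns the
sequence norm over `Φ(S)` into the one over `S`. If `f` interpolates the divided data on `S`, then
`g = (f ∘ Ψ) · ballFactor` interpolates the given data on `Φ(S)`. For `p = ∞` the factor is not
needed.

It remains to show `‖g‖_p ≤ ‖f‖_p`, which is done without boundary values. The real Jacobian of `Ψ`
is `K^(n+1)`, so changing variables in the integral of `|f|^p (1 - |x|²)^(s-1)` produces `K^s |g|^p
(1 - |x|²)^(s-1)`, and `K^s ≥ κ^s` for a constant `κ > 0` (`mul_lintegral_sphere_le`). As `s → 0+`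
the constant `κ^s` tends to `1` and the mass of the weight concentrates at the boundary. Since
spherical means increase with the radius (`lintegral_sphere_mono`), each mean of `g` is then bounded
by the supremum of the means of `f` (`lintegral_sphere_le_of_eq_ballKernel_mul`).

Monotonicity of the means holds for every exponent `q > 0` because `|f|^q` is subharmonic on complex
lines, by Jensen's formula and the convexity of `exp`. Rotation invariance of the sphere and the
maximum principle conclude. -/

/-! ### Subharmonicity in one complex variable and the maximum principle. -/

/-- The logarithm of the modulus of an analytic function satisfies the sub-mean value property. -/
theorem log_norm_le_circleAverage {f : ℂ → ℂ} {c : ℂ} {R : ℝ} (hR : 0 < R)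
    (hf : AnalyticOnNhd ℂ f (Metric.closedBall c R)) (hfc : f c ≠ 0) :
    Real.log ‖f c‖ ≤ Real.circleAverage (fun z => Real.log ‖f z‖) c R := by
  have hf' : AnalyticOnNhd ℂ f (Metric.closedBall c |R|) := by rwa [abs_of_pos hR]
  -- Jensen's formula: the excess over `log ‖f c‖` is a sum over the zeros `u` of multiplicity times
  -- `log (R / ‖c - u‖)`, with nonnegative terms.
  rw [hf'.circleAverage_log_norm hR.ne' hfc]
  refine le_add_of_nonneg_left (finsum_nonneg fun u => ?_)
  by_cases hu : u ∈ Metric.closedBall c |R|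
  · refine mul_nonneg ?_ ?_
    · exact_mod_cast MeromorphicOn.AnalyticOnNhd.divisor_nonneg hf' u
    · rcases eq_or_ne c u with rfl | hcu
      · simp
      · refine Real.log_nonneg ?_
        have h0 : 0 < ‖c - u‖ := norm_pos_iff.2 (sub_ne_zero.2 hcu)
        rw [← div_eq_mul_inv, le_div_iff₀ h0, one_mul, ← dist_eq_norm, dist_comm]
        simpa [abs_of_pos hR] using hu
  · rw [Function.locallyFinsuppWithin.apply_eq_zero_of_notMem _ hu]
    simp

/-- Powers of the modulus of an analytic function satisfy the sub-mean value property. -/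
theorem norm_rpow_le_circleAverage {f : ℂ → ℂ} {c : ℂ} {R q : ℝ} (hR : 0 < R) (hq : 0 < q)
    (hf : AnalyticOnNhd ℂ f (Metric.closedBall c R)) :
    ‖f c‖ ^ q ≤ Real.circleAverage (fun z => ‖f z‖ ^ q) c R := by
  by_cases hfc : f c = 0
  · rw [hfc, norm_zero, Real.zero_rpow hq.ne']
    exact Real.circleAverage_nonneg_of_nonneg fun z _ => by positivity
  have hsub : Metric.sphere c |R| ⊆ Metric.closedBall c R := by
    rw [abs_of_pos hR]; exact Metric.sphere_subset_closedBall
  have hA : 0 < ‖f c‖ := norm_pos_iff.2 hfc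
  set A := ‖f c‖ with hAdef
  have hne : f ⁻¹' {0}ᶜ ∈ Filter.codiscreteWithin (Metric.sphere c |R|) :=
    Filter.codiscreteWithin_mono hsub
      (hf.preimage_zero_mem_codiscreteWithin hfc (by simp [hR.le])
        ((convex_closedBall c R).isConnected ⟨c, by simp [hR.le]⟩))
  have hlogint : CircleIntegrable (fun z => Real.log ‖f z‖) c R :=
    MeromorphicOn.circleIntegrable_log_norm fun z hz => (hf z (hsub hz)).meromorphicAt
  -- The tangent line of `t ↦ exp (q t)` at `t = log A`, evaluated at `log ‖f z‖`: it lies below `‖f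
  -- z‖ ^ q`, and its average is controlled by that of `log ‖f‖`.
  let F : ℂ → ℝ := fun z => A ^ q * (1 - q * Real.log A) + A ^ q * q * Real.log ‖f z‖
  -- At a zero of `f` the convention `log 0 = 0` could make `F` exceed `‖f z‖ ^ q = 0`. Correcting
  -- `F` there leaves the average unchanged.
  let F' : ℂ → ℝ := fun z => if f z = 0 then 0 else F z
  have hFint : CircleIntegrable F c R := by
    refine (circleIntegrable_const _ c R).add ?_
    exact hlogint.const_smul (a := A ^ q * q)
  have hFF' : F =ᶠ[Filter.codiscreteWithin (Metric.sphere c |R|)] F' := by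
    filter_upwards [hne] with z hz
    have : f z ≠ 0 := hz
    simp [F', this]
  have hF'int : CircleIntegrable F' c R := hFint.congr_codiscreteWithin hFF'
  have hgint : CircleIntegrable (fun z => ‖f z‖ ^ q) c R := by
    refine ContinuousOn.circleIntegrable' ?_
    exact ((hf.continuousOn.mono hsub).norm).rpow_const fun _ _ => Or.inr hq.le
  have hle : Real.circleAverage F' c R ≤ Real.circleAverage (fun z => ‖f z‖ ^ q) c R := by
    refine Real.circleAverage_mono hF'int hgint fun z _ => ?_
    by_cases hz : f z = 0
    · simp only [F', hz, if_true]; positivity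
    · simp only [F', hz, if_false, F]
      have hz' : 0 < ‖f z‖ := norm_pos_iff.2 hz
      have h1 : ‖f z‖ ^ q = A ^ q * Real.exp (q * (Real.log ‖f z‖ - Real.log A)) := by
        rw [Real.rpow_def_of_pos hz', Real.rpow_def_of_pos hA, ← Real.exp_add]
        congr 1; ring
      rw [h1]
      have h2 := Real.add_one_le_exp (q * (Real.log ‖f z‖ - Real.log A))
      have h3 : 0 < A ^ q := by positivity
      nlinarith [mul_le_mul_of_nonneg_left h2 h3.le]
  refine le_trans ?_ hle
  rw [← Real.circleAverage_congr_codiscreteWithin hFF' hR.ne']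
  have h4 : Real.circleAverage F c R = A ^ q * (1 - q * Real.log A)
      + A ^ q * q * Real.circleAverage (fun z => Real.log ‖f z‖) c R := by
    have h6 := Real.circleAverage_add (circleIntegrable_const (A ^ q * (1 - q * Real.log A)) c R)
      (hlogint.const_smul (a := A ^ q * q))
    rw [Real.circleAverage_const, Real.circleAverage_smul] at h6
    exact h6
  rw [h4]
  have h5 := log_norm_le_circleAverage hR hf hfc
  have h3 : 0 < A ^ q * q := by positivity
  nlinarith [mul_le_mul_of_nonneg_left h5 h3.le]

/-- The maximum principle for continuous functions with the sub-mean value property. -/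
theorem exists_mem_sphere_le_of_le_circleAverage {u : ℂ → ℝ} {R : ℝ}
    (hu : ContinuousOn u (Metric.closedBall 0 R))
    (hmean : ∀ c ρ, 0 < ρ → Metric.closedBall c ρ ⊆ Metric.ball 0 R →
      u c ≤ Real.circleAverage u c ρ) {z : ℂ} (hz : z ∈ Metric.closedBall (0 : ℂ) R) :
    ∃ w ∈ Metric.sphere (0 : ℂ) R, u z ≤ u w := by
  obtain ⟨m, hmB, hm⟩ := (isCompact_closedBall (0 : ℂ) R).exists_isMaxOn ⟨z, hz⟩ hu
  have hMc : IsCompact (Metric.closedBall (0 : ℂ) R ∩ u ⁻¹' {u m}) :=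
    (isCompact_closedBall (0 : ℂ) R).of_isClosed_subset
      (hu.preimage_isClosed_of_isClosed Metric.isClosed_closedBall isClosed_singleton)
      Set.inter_subset_left
  -- Among the maximum points, `w` has the largest modulus. If it were interior, a small circle
  -- around it would contain a point of larger modulus, where `u` is strictly below its maximum, and
  -- the average over the circle would be too small.
  obtain ⟨w, ⟨hwB, hwm⟩, hw⟩ := hMc.exists_isMaxOn ⟨m, hmB, rfl⟩ continuous_norm.continuousOn
  have hwm : u w = u m := hwm
  refine ⟨w, ?_, hwm ▸ hm hz⟩
  rw [mem_closedBall_zero_iff] at hwB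
  rw [mem_sphere_zero_iff_norm]
  by_contra hne
  have hlt : ‖w‖ < R := lt_of_le_of_ne hwB hne
  set ρ := (R - ‖w‖) / 2 with hρ
  have hρ0 : 0 < ρ := by rw [hρ]; linarith
  have hsub : Metric.closedBall w ρ ⊆ Metric.ball 0 R := by
    intro x hx
    rw [mem_closedBall_iff_norm] at hx
    rw [mem_ball_zero_iff]
    have := norm_le_norm_add_norm_sub' x w
    linarith
  have hcirc : ∀ θ, circleMap w ρ θ ∈ Metric.closedBall (0 : ℂ) R := fun θ =>
    Metric.ball_subset_closedBall (hsub (circleMap_mem_closedBall w hρ0.le θ))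
  have hcont : Continuous fun θ => u (circleMap w ρ θ) :=
    hu.comp_continuous (continuous_circleMap w ρ) hcirc
  have hnorm : ∃ θ ∈ Set.Icc (0 : ℝ) (2 * Real.pi), ‖w‖ < ‖circleMap w ρ θ‖ := by
    obtain ⟨θ, hθ, hθw⟩ : ∃ θ ∈ Set.Icc (0 : ℝ) (2 * Real.pi),
        w = ‖w‖ * Complex.exp (θ * Complex.I) := by
      -- The argument of `w` is moved into `[0, 2π)`, the range of integration of the circle
      -- average.
      refine ⟨toIcoMod Real.two_pi_pos 0 w.arg, ?_, ?_⟩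
      · have := toIcoMod_mem_Ico Real.two_pi_pos 0 w.arg
        rw [zero_add] at this
        exact Set.Ico_subset_Icc_self this
      · conv_lhs => rw [← Complex.norm_mul_exp_arg_mul_I w]
        congr 1
        rw [Complex.exp_eq_exp_iff_exists_int]
        refine ⟨toIcoDiv Real.two_pi_pos 0 w.arg, ?_⟩
        rw [toIcoMod]
        push_cast
        simp only [zsmul_eq_mul]
        ring
    refine ⟨θ, hθ, ?_⟩
    have : circleMap w ρ θ = ((‖w‖ + ρ : ℝ) : ℂ) * Complex.exp (θ * Complex.I) := by
      rw [circleMap]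
      nth_rewrite 1 [hθw]
      push_cast; ring
    rw [this, norm_mul, Complex.norm_exp_ofReal_mul_I, mul_one, Complex.norm_real,
      Real.norm_of_nonneg (by positivity)]
    linarith
  obtain ⟨θ, hθ, hθw⟩ := hnorm
  have hlt' : u (circleMap w ρ θ) < u m := by
    refine lt_of_le_of_ne (hm (hcirc θ)) fun h => ?_
    exact absurd (hw ⟨hcirc θ, h⟩) (not_le.2 hθw)
  have h1 := hmean w ρ hρ0 hsub
  have h2 : ∫ θ in (0 : ℝ)..2 * Real.pi, u (circleMap w ρ θ)
      < ∫ _ in (0 : ℝ)..2 * Real.pi, u m :=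
    intervalIntegral.integral_lt_integral_of_continuousOn_of_le_of_exists_lt Real.two_pi_pos
      hcont.continuousOn continuousOn_const (fun x _ => hm (hcirc x)) ⟨θ, hθ, hlt'⟩
  rw [intervalIntegral.integral_const, sub_zero, smul_eq_mul] at h2
  rw [Real.circleAverage_def, smul_eq_mul, hwm] at h1
  have h3 := mul_lt_mul_of_pos_left h2 (inv_pos.2 Real.two_pi_pos)
  rw [inv_mul_cancel_left₀ Real.two_pi_pos.ne'] at h3
  linarith
-- The involutions of the ball and their Jacobians.
/-- The number `√(1 - |c|²)`. -/
noncomputable def ballDefect {n : ℕ} (c : Cn n) : ℝ := √(1 - ‖c‖ ^ 2)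

/-- The involutive automorphism of the unit ball that exchanges `0` and `c`. -/
noncomputable def ballInvolution {n : ℕ} (c z : Cn n) : Cn n :=
  -- The inner product is linear in its second argument, so this is holomorphic in `z`. With `s =
  -- ballDefect c`, the usual coefficient `(1 - s) / |c|²` of the projection term is written `1 / (1
  -- + s)`, which also covers `c = 0`.
  (1 - inner ℂ c z)⁻¹ •
    (c - (ballDefect c : ℂ) • z - (inner ℂ c z / (1 + ballDefect c : ℂ)) • c)

/-- The invariant Poisson kernel `(1 - |c|²) / |1 - ⟨z, c⟩|²`, before raising it to the `n`-th
power. -/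
noncomputable def ballKernel {n : ℕ} (c z : Cn n) : ℝ :=
  (1 - ‖c‖ ^ 2) / ‖1 - inner ℂ c z‖ ^ 2

section Involution

variable {n : ℕ} {c z : Cn n}

theorem mem_unitBall_iff : z ∈ unitBall n ↔ ‖z‖ < 1 := mem_ball_zero_iff

theorem isOpen_unitBall : IsOpen (unitBall n) := Metric.isOpen_ball

theorem ballDefect_pos (hc : c ∈ unitBall n) : 0 < ballDefect c := by
  rw [mem_unitBall_iff] at hc
  exact Real.sqrt_pos.2 (by nlinarith [norm_nonneg c])

theorem ballDefect_sq (hc : c ∈ unitBall n) : ballDefect c ^ 2 = 1 - ‖c‖ ^ 2 := by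
  rw [mem_unitBall_iff] at hc
  exact Real.sq_sqrt (by nlinarith [norm_nonneg c])

theorem ofReal_ballDefect_sq (hc : c ∈ unitBall n) :
    (ballDefect c : ℂ) ^ 2 = 1 - (‖c‖ : ℂ) ^ 2 := by
  exact_mod_cast congrArg (fun x : ℝ => (x : ℂ)) (ballDefect_sq hc)

theorem ofReal_ballDefect_ne_zero (hc : c ∈ unitBall n) : (ballDefect c : ℂ) ≠ 0 := by
  exact_mod_cast (ballDefect_pos hc).ne'

theorem one_add_ballDefect_ne_zero (hc : c ∈ unitBall n) : (1 + ballDefect c : ℂ) ≠ 0 := by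
  have := ballDefect_pos hc
  exact_mod_cast (by linarith : (0 : ℝ) < 1 + ballDefect c).ne'

theorem norm_inner_lt_one (hc : c ∈ unitBall n) (hz : z ∈ unitBall n) :
    ‖inner ℂ c z‖ < 1 := by
  rw [mem_unitBall_iff] at hc hz
  calc ‖inner ℂ c z‖ ≤ ‖c‖ * ‖z‖ := norm_inner_le_norm c z
    _ < 1 := by nlinarith [norm_nonneg c, norm_nonneg z]

theorem one_sub_inner_re_pos (hc : c ∈ unitBall n) (hz : z ∈ unitBall n) :
    0 < (1 - inner ℂ c z : ℂ).re := by
  have h1 := norm_inner_lt_one hc hz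
  have h2 := Complex.re_le_norm (inner ℂ c z)
  rw [Complex.sub_re, Complex.one_re]
  linarith

theorem one_sub_inner_ne_zero (hc : c ∈ unitBall n) (hz : z ∈ unitBall n) :
    (1 - inner ℂ c z : ℂ) ≠ 0 := fun h => by
  have := one_sub_inner_re_pos hc hz
  rw [h, Complex.zero_re] at this
  exact lt_irrefl _ this

theorem ballKernel_pos (hc : c ∈ unitBall n) (hz : z ∈ unitBall n) : 0 < ballKernel c z := by
  rw [ballKernel, ← ballDefect_sq hc]
  have := ballDefect_pos hc
  have := norm_pos_iff.2 (one_sub_inner_ne_zero hc hz)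
  positivity

/-- The bound is uniform in `z`, so its `s`-th power tends to `1` as `s → 0`, uniformly over the
ball. -/
theorem le_ballKernel (hc : c ∈ unitBall n) (hz : z ∈ unitBall n) :
    (1 - ‖c‖ ^ 2) / 4 ≤ ballKernel c z := by
  have h1 := norm_inner_lt_one hc hz
  have h2 : ‖(1 - inner ℂ c z : ℂ)‖ ≤ 2 := by
    have := norm_sub_le (1 : ℂ) (inner ℂ c z)
    rw [norm_one] at this
    linarith
  have h3 := norm_pos_iff.2 (one_sub_inner_ne_zero hc hz)
  rw [ballKernel, ← ballDefect_sq hc]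
  gcongr
  nlinarith

/-- This is the denominator that appears when the involution is applied twice; it also evaluates the
determinant of the derivative. -/
theorem inner_ballInvolution (hc : c ∈ unitBall n) (hz : z ∈ unitBall n) :
    1 - inner ℂ c (ballInvolution c z) = (ballDefect c : ℂ) ^ 2 / (1 - inner ℂ c z) := by
  have h1 := one_sub_inner_ne_zero hc hz
  have h2 := one_add_ballDefect_ne_zero hc
  have h3 : (‖c‖ : ℂ) ^ 2 = 1 - (ballDefect c : ℂ) ^ 2 := by rw [ofReal_ballDefect_sq hc]; ring
  rw [ballInvolution, inner_smul_right, inner_sub_right, inner_sub_right, inner_smul_right,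
    inner_smul_right, inner_self_eq_norm_sq_to_K]
  simp only [Complex.coe_algebraMap]
  rw [h3]
  field_simp
  ring

/-- A computation in the real and imaginary parts of `⟨z, c⟩`. It governs both the transformation of
the sequence weights and that of the radial weights in the integrals. -/
theorem one_sub_norm_ballInvolution_sq (hc : c ∈ unitBall n) (hz : z ∈ unitBall n) :
    1 - ‖ballInvolution c z‖ ^ 2 = ballKernel c z * (1 - ‖z‖ ^ 2) := by
  have h1 := norm_pos_iff.2 (one_sub_inner_ne_zero hc hz)
  have hs := ballDefect_pos hc
  have h3 := ballDefect_sq hc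
  have hα : c - (ballDefect c : ℂ) • z - (inner ℂ c z / (1 + ballDefect c : ℂ)) • c
      = (1 - inner ℂ c z / (1 + ballDefect c : ℂ)) • c - (ballDefect c : ℂ) • z := by module
  rw [ballInvolution, hα, norm_smul, norm_inv, mul_pow, ballKernel, ← h3,
    @norm_sub_sq ℂ, inner_smul_left, inner_smul_right, norm_smul, norm_smul]
  set s := ballDefect c
  set t : ℂ := inner ℂ c z with ht
  have hw : ‖1 - t‖ ^ 2 = (1 - t.re) ^ 2 + t.im ^ 2 := by
    rw [← Complex.normSq_eq_norm_sq, Complex.normSq_apply]; simp; ring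
  have hα' : (1 - t / (1 + s : ℂ)) = ((1 - t.re / (1 + s) : ℝ) : ℂ)
      + ((-(t.im / (1 + s)) : ℝ) : ℂ) * Complex.I := by
    nth_rewrite 1 [← Complex.re_add_im t]
    push_cast
    ring
  have hα2 : ‖1 - t / (1 + s : ℂ)‖ ^ 2 = (1 - t.re / (1 + s)) ^ 2 + (t.im / (1 + s)) ^ 2 := by
    rw [hα', ← Complex.normSq_eq_norm_sq, Complex.normSq_add_mul_I]
    ring
  have hre : RCLike.re ((starRingEnd ℂ) (1 - t / (1 + s : ℂ)) * ((s : ℂ) * t))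
      = s * ((1 - t.re / (1 + s)) * t.re - (t.im / (1 + s)) * t.im) := by
    rw [hα']
    generalize 1 - t.re / (1 + s) = A
    generalize t.im / (1 + s) = B
    simp
    ring
  rw [hre, mul_pow, mul_pow, hα2, Complex.norm_real, Real.norm_of_nonneg hs.le,
    show ‖c‖ ^ 2 = 1 - s ^ 2 by linarith]
  have hs1 : 1 + s ≠ 0 := by positivity
  have hw0 : (1 - t.re) ^ 2 + t.im ^ 2 ≠ 0 := by rw [← hw]; positivity
  rw [inv_pow, hw]
  field_simp
  ring

theorem ballInvolution_mem (hc : c ∈ unitBall n) (hz : z ∈ unitBall n) :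
    ballInvolution c z ∈ unitBall n := by
  have h := one_sub_norm_ballInvolution_sq hc hz
  have hK := ballKernel_pos hc hz
  rw [mem_unitBall_iff] at hz ⊢
  have : 0 < ballKernel c z * (1 - ‖z‖ ^ 2) := mul_pos hK (by nlinarith [norm_nonneg z])
  nlinarith [norm_nonneg (ballInvolution c z)]

theorem ballInvolution_ballInvolution (hc : c ∈ unitBall n) (hz : z ∈ unitBall n) :
    ballInvolution c (ballInvolution c z) = z := by
  have h1 := one_sub_inner_ne_zero hc hz
  have h2 := one_add_ballDefect_ne_zero hc
  have hs := ofReal_ballDefect_ne_zero hc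
  have hi := inner_ballInvolution hc hz
  have hi' : inner ℂ c (ballInvolution c z)
      = 1 - (ballDefect c : ℂ) ^ 2 / (1 - inner ℂ c z) := by rw [← hi]; ring
  rw [ballInvolution, hi, hi', ballInvolution]
  ext i
  simp only [PiLp.smul_apply, PiLp.sub_apply, smul_eq_mul]
  field_simp
  ring

theorem ballInvolution_zero : ballInvolution c 0 = c := by
  simp [ballInvolution]

theorem zero_mem_unitBall : (0 : Cn n) ∈ unitBall n := by simp [mem_unitBall_iff]

theorem ballInvolution_self (hc : c ∈ unitBall n) : ballInvolution c c = 0 := by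
  have := ballInvolution_ballInvolution hc (zero_mem_unitBall (n := n))
  rwa [ballInvolution_zero] at this

/-- The complex derivative of `ballInvolution c` at a point of the ball is a multiple of a
transvection. -/
theorem hasFDerivAt_ballInvolution (hc : c ∈ unitBall n) (hz : z ∈ unitBall n) :
    HasFDerivAt (𝕜 := ℂ) (ballInvolution c) (LinearMap.toContinuousLinearMap
      ((-(ballDefect c : ℂ) / (1 - inner ℂ c z)) • LinearMap.transvection
        (innerSL ℂ c : Cn n →ₗ[ℂ] ℂ)
        ((ballDefect c : ℂ)⁻¹ • ((1 + ballDefect c : ℂ)⁻¹ • c - ballInvolution c z)))) z := by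
  have h1 := one_sub_inner_ne_zero hc hz
  have h2 := one_add_ballDefect_ne_zero hc
  have hs := ofReal_ballDefect_ne_zero hc
  have ht : HasFDerivAt (𝕜 := ℂ) (fun z : Cn n => inner ℂ c z) (innerSL ℂ c) z :=
    (innerSL ℂ c).hasFDerivAt
  have hw : HasFDerivAt (𝕜 := ℂ) (fun z : Cn n => (1 - inner ℂ c z)⁻¹) _ z :=
    (hasFDerivAt_inv h1).comp z (ht.const_sub 1)
  have hN : HasFDerivAt (𝕜 := ℂ) (fun z : Cn n => c - (ballDefect c : ℂ) • z
      - (inner ℂ c z / (1 + ballDefect c : ℂ)) • c) _ z :=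
    (((hasFDerivAt_id z).const_smul (ballDefect c : ℂ)).const_sub c).sub
      ((ht.mul_const (1 + ballDefect c : ℂ)⁻¹).smul_const c)
  refine (hw.smul hN).congr_fderiv ?_
  ext h i
  simp [LinearMap.transvection, ballInvolution]
  field_simp
  ring

theorem differentiableOn_ballInvolution (hc : c ∈ unitBall n) :
    DifferentiableOn ℂ (ballInvolution c) (unitBall n) := fun _ hz =>
  (hasFDerivAt_ballInvolution hc hz).differentiableAt.differentiableWithinAt

/-- The transvection along `v` has determinant `1 + ⟨v, c⟩`, which here equals `s / (1 - ⟨z, c⟩)`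
with `s = ballDefect c`. The scalar in front contributes its `n`-th power. -/
theorem det_fderiv_ballInvolution (hc : c ∈ unitBall n) (hz : z ∈ unitBall n) :
    LinearMap.det ((-(ballDefect c : ℂ) / (1 - inner ℂ c z)) • LinearMap.transvection
        (innerSL ℂ c : Cn n →ₗ[ℂ] ℂ)
        ((ballDefect c : ℂ)⁻¹ • ((1 + ballDefect c : ℂ)⁻¹ • c - ballInvolution c z)))
      = (-1) ^ n * ((ballDefect c : ℂ) / (1 - inner ℂ c z)) ^ (n + 1) := by
  have h1 := one_sub_inner_ne_zero hc hz
  have h2 := one_add_ballDefect_ne_zero hc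
  have hs := ofReal_ballDefect_ne_zero hc
  have hi := inner_ballInvolution hc hz
  have hi' : inner ℂ c (ballInvolution c z)
      = 1 - (ballDefect c : ℂ) ^ 2 / (1 - inner ℂ c z) := by rw [← hi]; ring
  have h3 : (‖c‖ : ℂ) ^ 2 = 1 - (ballDefect c : ℂ) ^ 2 := by rw [ofReal_ballDefect_sq hc]; ring
  rw [LinearMap.det_smul, LinearMap.transvection.det, finrank_euclideanSpace_fin]
  have h4 : 1 + (innerSL ℂ c : Cn n →ₗ[ℂ] ℂ)
      ((ballDefect c : ℂ)⁻¹ • ((1 + ballDefect c : ℂ)⁻¹ • c - ballInvolution c z))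
      = (ballDefect c : ℂ) / (1 - inner ℂ c z) := by
    rw [ContinuousLinearMap.coe_coe, innerSL_apply_apply, inner_smul_right, inner_sub_right,
      inner_smul_right, inner_self_eq_norm_sq_to_K, hi']
    simp only [Complex.coe_algebraMap]
    rw [h3]
    field_simp
    ring
  rw [h4, pow_succ, ← mul_assoc, ← mul_pow]
  congr 2
  ring

/-- The real Jacobian determinant of `ballInvolution c`. -/
theorem abs_det_real_fderiv_ballInvolution (hc : c ∈ unitBall n) (hz : z ∈ unitBall n) :
    |((LinearMap.toContinuousLinearMap
      ((-(ballDefect c : ℂ) / (1 - inner ℂ c z)) • LinearMap.transvection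
        (innerSL ℂ c : Cn n →ₗ[ℂ] ℂ)
        ((ballDefect c : ℂ)⁻¹ • ((1 + ballDefect c : ℂ)⁻¹ • c - ballInvolution c z)))
        ).restrictScalars ℝ).det| = ballKernel c z ^ (n + 1) := by
  -- The real determinant of a complex linear map is the squared modulus of its complex determinant.
  rw [ContinuousLinearMap.det, ContinuousLinearMap.coe_restrictScalars,
    LinearMap.coe_toContinuousLinearMap, LinearMap.det_restrictScalars,
    det_fderiv_ballInvolution hc hz, Algebra.norm_complex_eq]
  change |Complex.normSq _| = _
  rw [map_mul, map_pow, map_pow, map_div₀, Complex.normSq_neg, map_one, one_pow, one_mul,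
    Complex.normSq_ofReal, Complex.normSq_eq_norm_sq, ballKernel, ← sq, ballDefect_sq hc,
    abs_of_nonneg]
  rw [← ballDefect_sq hc]
  positivity

end Involution
-- Cartan's theorem and the change of variables.
section Automorphism

variable {n : ℕ}

/-- **Cartan's theorem**: an automorphism of the unit ball that fixes the origin is a linear
isometry. -/
theorem exists_linearIsometry_eqOn_of_fixes_zero {F G : Cn n → Cn n}
    (hF : DifferentiableOn ℂ F (unitBall n)) (hFm : Set.MapsTo F (unitBall n) (unitBall n))
    (hG : DifferentiableOn ℂ G (unitBall n)) (hGm : Set.MapsTo G (unitBall n) (unitBall n))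
    (hF0 : F 0 = 0) (hG0 : G 0 = 0) (hGF : Set.LeftInvOn G F (unitBall n)) :
    ∃ L : Cn n →ₗᵢ[ℂ] Cn n, Set.EqOn F L (unitBall n) := by
  have hcl : ∀ {H : Cn n → Cn n}, Set.MapsTo H (unitBall n) (unitBall n) →
      Set.MapsTo H (Metric.ball 0 1) (Metric.closedBall 0 1) := fun h =>
    Set.MapsTo.mono_right h Metric.ball_subset_closedBall
  -- The Schwarz lemma for `F` and for its left inverse `G` gives the two inequalities.
  have hnorm : ∀ z ∈ unitBall n, ‖F z‖ = ‖z‖ := fun z hz => by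
    refine le_antisymm (Complex.norm_le_norm_of_mapsTo_ball hF (hcl hFm) hF0
      (mem_unitBall_iff.1 hz)) ?_
    have := Complex.norm_le_norm_of_mapsTo_ball hG (hcl hGm) hG0 (mem_unitBall_iff.1 (hFm hz))
    rwa [hGF hz] at this
  have hderiv : HasFDerivAt F (fderiv ℂ F 0) 0 :=
    (hF.differentiableAt (isOpen_unitBall.mem_nhds zero_mem_unitBall)).hasFDerivAt
  have heq : ∀ z ∈ unitBall n, F z = fderiv ℂ F 0 z := fun z hz => by
    rcases eq_or_ne z 0 with rfl | hz0
    · simp [hF0]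
    have hzpos := norm_pos_iff.2 hz0
    have hz1 := mem_unitBall_iff.1 hz
    have hmaps : Set.MapsTo (fun l : ℂ => l • z) (Metric.ball 0 ‖z‖⁻¹) (unitBall n) := by
      intro l hl
      rw [mem_ball_zero_iff, ← one_div, lt_div_iff₀ hzpos] at hl
      rwa [mem_unitBall_iff, norm_smul]
    have hd : DifferentiableOn ℂ (fun l : ℂ => F (l • z)) (Metric.ball 0 ‖z‖⁻¹) :=
      hF.comp (by fun_prop) hmaps
    have h1 : (1 : ℂ) ∈ Metric.ball (0 : ℂ) ‖z‖⁻¹ := by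
      rw [mem_ball_zero_iff, norm_one]
      exact (one_lt_inv₀ hzpos).2 hz1
    have hdslope : dslope (fun l : ℂ => F (l • z)) 0 1 = F z := by
      rw [dslope_of_ne _ one_ne_zero, slope_def_module]
      simp [hF0]
    -- Equality case of the Schwarz lemma on the slice `l ↦ F (l • z)`, which lives on the disc of
    -- radius `1 / ‖z‖`: norm preservation makes the slope at `l = 1` extremal, so the slice is
    -- linear and `F z` is the derivative at `0` in direction `z`.
    have haff := Complex.affine_of_mapsTo_ball_of_norm_dslope_eq_div (R₂ := 1) hd
      (by
        rw [zero_smul, hF0]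
        exact fun l hl => Metric.ball_subset_closedBall (hFm (hmaps hl))) h1
      (by rw [hdslope, hnorm z hz, one_div, inv_inv])
    have hder1 : HasDerivAt (fun l : ℂ => F (l • z)) (F z) 0 := by
      have : HasDerivAt (fun l : ℂ => l • F z) (F z) 0 := by
        simpa using (hasDerivAt_id (0 : ℂ)).smul_const (F z)
      refine this.congr_of_eventuallyEq ?_
      filter_upwards [Metric.ball_mem_nhds (0 : ℂ) (inv_pos.2 hzpos)] with l hl
      have := haff hl
      simp only [hdslope, zero_smul, hF0, sub_zero, zero_add] at this
      exact this
    have hder2 : HasDerivAt (fun l : ℂ => F (l • z)) (fderiv ℂ F 0 z) 0 := by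
      have h2 : HasDerivAt (fun l : ℂ => l • z) z 0 := by
        simpa using (hasDerivAt_id (0 : ℂ)).smul_const z
      have h3 : HasFDerivAt F (fderiv ℂ F 0) ((0 : ℂ) • z) := by rwa [zero_smul]
      exact h3.comp_hasDerivAt 0 h2
    exact hder1.unique hder2
  refine ⟨⟨(fderiv ℂ F 0).toLinearMap, fun z => ?_⟩, heq⟩
  have hr : (0 : ℝ) < 2 * (‖z‖ + 1) := by positivity
  -- An arbitrary vector is scaled into the ball, where the norm is already known to be preserved.
  set r : ℝ := (2 * (‖z‖ + 1))⁻¹ with hrdef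
  have hr0 : 0 < r := inv_pos.2 hr
  have hm : (r : ℂ) • z ∈ unitBall n := by
    rw [mem_unitBall_iff, norm_smul, Complex.norm_real, Real.norm_of_nonneg hr0.le, hrdef,
      inv_mul_lt_iff₀ hr]
    linarith [norm_nonneg z]
  have h := hnorm _ hm
  rw [heq _ hm, map_smul, norm_smul, norm_smul, Complex.norm_real,
    Real.norm_of_nonneg hr0.le] at h
  exact mul_left_cancel₀ hr0.ne' h

/-- The inverse of an automorphism `Φ` of the unit ball is an involution followed by a linear
isometry. -/
theorem exists_linearIsometry_comp_ballInvolution {Φ Ψ : Cn n → Cn n}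
    (hΦ : DifferentiableOn ℂ Φ (unitBall n)) (hΦm : Set.MapsTo Φ (unitBall n) (unitBall n))
    (hΨ : DifferentiableOn ℂ Ψ (unitBall n)) (hΨm : Set.MapsTo Ψ (unitBall n) (unitBall n))
    (hinv : Set.InvOn Ψ Φ (unitBall n) (unitBall n)) :
    ∃ L : Cn n →ₗᵢ[ℂ] Cn n, ∀ z ∈ unitBall n, Ψ z = L (ballInvolution (Φ 0) z) := by
  have hc : Φ 0 ∈ unitBall n := hΦm zero_mem_unitBall
  have hm : Set.MapsTo (ballInvolution (Φ 0)) (unitBall n) (unitBall n) :=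
    fun _ => ballInvolution_mem hc
  obtain ⟨L, hL⟩ := exists_linearIsometry_eqOn_of_fixes_zero
    (F := Ψ ∘ ballInvolution (Φ 0)) (G := ballInvolution (Φ 0) ∘ Φ)
    (hΨ.comp (differentiableOn_ballInvolution hc) hm) (hΨm.comp hm)
    ((differentiableOn_ballInvolution hc).comp hΦ hΦm) (hm.comp hΦm)
    (by simp [ballInvolution_zero, hinv.1 zero_mem_unitBall])
    (by simp [ballInvolution_self hc])
    (fun z hz => by
      simp only [Function.comp_apply]
      rw [hinv.2 (hm hz), ballInvolution_ballInvolution hc hz])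
  refine ⟨L, fun z hz => ?_⟩
  rw [← hL (hm hz), Function.comp_apply, ballInvolution_ballInvolution hc hz]

/-- Change of variables for a ball automorphism in the Lebesgue measure of the ball. -/
theorem setLIntegral_comp_ballInvolution {c : Cn n} (hc : c ∈ unitBall n)
    (L : Cn n →ₗᵢ[ℂ] Cn n) (g : Cn n → ℝ≥0∞) :
    ∫⁻ x in unitBall n, ENNReal.ofReal (ballKernel c x ^ (n + 1)) * g (L (ballInvolution c x))
      = ∫⁻ x in unitBall n, g x := by
  have himage : ballInvolution c '' unitBall n = unitBall n := by
    refine subset_antisymm (Set.image_subset_iff.2 fun x hx => ballInvolution_mem hc hx) ?_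
    exact fun x hx => ⟨_, ballInvolution_mem hc hx, ballInvolution_ballInvolution hc hx⟩
  have hinj : Set.InjOn (ballInvolution c) (unitBall n) := fun x hx y hy h => by
    rw [← ballInvolution_ballInvolution hc hx, h, ballInvolution_ballInvolution hc hy]
  have h1 := lintegral_image_eq_lintegral_abs_det_fderiv_mul volume
    isOpen_unitBall.measurableSet
    (fun x hx => ((hasFDerivAt_ballInvolution hc hx).restrictScalars ℝ).hasFDerivWithinAt)
    hinj (fun x => g (L x))
  rw [himage] at h1
  let e : Cn n ≃ₗᵢ[ℝ] Cn n :=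
    { toLinearEquiv := (L.toLinearIsometryEquiv rfl).toLinearEquiv.restrictScalars ℝ
      norm_map' := L.norm_map }
  have he : ∀ x, e x = L x := fun _ => rfl
  have h2 := e.measurePreserving.setLIntegral_comp_preimage_emb
    e.toHomeomorph.measurableEmbedding g (unitBall n)
  have h3 : e ⁻¹' unitBall n = unitBall n := by
    ext x
    rw [Set.mem_preimage, mem_unitBall_iff, mem_unitBall_iff, e.norm_map]
  rw [h3] at h2
  simp only [he] at h2
  rw [← h2, h1]
  refine setLIntegral_congr_fun isOpen_unitBall.measurableSet fun x hx => ?_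
  simp only
  rw [abs_det_real_fderiv_ballInvolution hc hx]

end Automorphism
-- Invariance of the surface measure and polar coordinates.
section Sphere

open scoped Pointwise

variable {n : ℕ}

/-- A linear isometry, restricted to the unit sphere. -/
noncomputable def sphereMap (e : Cn n ≃ₗᵢ[ℝ] Cn n) (x : Metric.sphere (0 : Cn n) 1) :
    Metric.sphere (0 : Cn n) 1 :=
  ⟨e x, by rw [mem_sphere_zero_iff_norm, e.norm_map]; exact mem_sphere_zero_iff_norm.1 x.2⟩

/-- Up to a constant, the surface measure of a set is the volume of the cone over it, and a linear
isometry carries cones to cones and preserves volume. -/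
theorem measurePreserving_sphereMap (e : Cn n ≃ₗᵢ[ℝ] Cn n) :
    MeasurePreserving (sphereMap e) (sphereMeasure n) (sphereMeasure n) := by
  have hmeas : Measurable (sphereMap e) :=
    ((e.continuous.comp continuous_subtype_val).subtype_mk _).measurable
  refine MeasurePreserving.smul_measure ⟨hmeas, ?_⟩ _
  ext s hs
  rw [Measure.map_apply hmeas hs, Measure.toSphere_apply' _ hs,
    Measure.toSphere_apply' _ (hmeas hs)]
  congr 1
  have h : Set.Ioo (0 : ℝ) 1 • ((↑) '' (sphereMap e ⁻¹' s) : Set (Cn n))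
      = e ⁻¹' (Set.Ioo (0 : ℝ) 1 • ((↑) '' s : Set (Cn n))) := by
    ext x
    simp only [Set.mem_smul, Set.mem_preimage, Set.mem_image]
    constructor
    · rintro ⟨r, hr, _, ⟨y, hy, rfl⟩, rfl⟩
      exact ⟨r, hr, _, ⟨_, hy, rfl⟩, (map_smul e r (y : Cn n)).symm⟩
    · rintro ⟨r, hr, _, ⟨y, hy, rfl⟩, hx⟩
      have hy' : sphereMap e (sphereMap e.symm y) = y := Subtype.ext (e.apply_symm_apply _)
      refine ⟨r, hr, _, ⟨sphereMap e.symm y, ?_, rfl⟩, ?_⟩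
      · rwa [hy']
      · apply e.injective
        rw [← hx, map_smul]
        exact congrArg (r • ·) (congrArg Subtype.val hy')
  rw [h]
  exact e.measurePreserving.measure_preimage_emb e.toHomeomorph.measurableEmbedding _

/-- The surface measure of the unit sphere is invariant under unimodular scalars. -/
theorem lintegral_sphereMeasure_smul {a : ℂ} (ha : ‖a‖ = 1) {g : Cn n → ℝ≥0∞}
    (hg : Measurable fun x : Metric.sphere (0 : Cn n) 1 => g x) :
    ∫⁻ x, g (a • (x : Cn n)) ∂(sphereMeasure n) = ∫⁻ x, g x ∂(sphereMeasure n) := by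
  have ha0 : a ≠ 0 := norm_pos_iff.1 (by rw [ha]; exact one_pos)
  let e : Cn n ≃ₗᵢ[ℝ] Cn n :=
    { toLinearEquiv := (LinearEquiv.smulOfNeZero ℂ (Cn n) a ha0).restrictScalars ℝ
      norm_map' := fun x => by
        change ‖a • x‖ = ‖x‖
        rw [norm_smul, ha, one_mul] }
  exact (measurePreserving_sphereMap e).lintegral_comp hg

theorem toSphere_univ_ne_zero (hn : 1 ≤ n) :
    (volume : Measure (Cn n)).toSphere Set.univ ≠ 0 := by
  have : Nonempty (Fin n) := ⟨⟨0, hn⟩⟩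
  rw [Ne, Measure.measure_univ_eq_zero]
  exact Measure.toSphere_ne_zero _

theorem isFiniteMeasure_sphereMeasure (hn : 1 ≤ n) : IsFiniteMeasure (sphereMeasure n) := by
  refine ⟨?_⟩
  rw [sphereMeasure, Measure.smul_apply, smul_eq_mul]
  exact ENNReal.mul_lt_top (ENNReal.inv_lt_top.2 (pos_iff_ne_zero.2 (toSphere_univ_ne_zero hn)))
    (measure_lt_top _ _)

theorem toSphere_eq_smul_sphereMeasure (hn : 1 ≤ n) :
    (volume : Measure (Cn n)).toSphere
      = (volume : Measure (Cn n)).toSphere Set.univ • sphereMeasure n := by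
  rw [sphereMeasure, smul_smul, ENNReal.mul_inv_cancel (toSphere_univ_ne_zero hn)
    (measure_ne_top _ _), one_smul]

/-- Integration in polar coordinates. -/
theorem lintegral_eq_lintegral_sphere {g : Cn n → ℝ≥0∞} (hn : 1 ≤ n) (hg : Measurable g) :
    ∫⁻ x, g x = (volume : Measure (Cn n)).toSphere Set.univ *
      ∫⁻ r in Set.Ioi (0 : ℝ), ENNReal.ofReal (r ^ (Module.finrank ℝ (Cn n) - 1)) *
        ∫⁻ ζ, g (r • (ζ : Cn n)) ∂(sphereMeasure n) := by
  have := isFiniteMeasure_sphereMeasure hn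
  have : Nonempty (Fin n) := ⟨⟨0, hn⟩⟩
  set d := Module.finrank ℝ (Cn n) - 1
  set τ := (volume : Measure (Cn n)).toSphere Set.univ
  have hcont : Continuous fun p : Metric.sphere (0 : Cn n) 1 × Set.Ioi (0 : ℝ) =>
      (p.2 : ℝ) • (p.1 : Cn n) := by fun_prop
  have hcont' : Continuous fun p : ℝ × Metric.sphere (0 : Cn n) 1 => p.1 • (p.2 : Cn n) := by
    fun_prop
  have hG : Measurable fun r : ℝ => ∫⁻ ζ, g (r • (ζ : Cn n)) ∂(sphereMeasure n) :=
    (hg.comp hcont'.measurable).lintegral_prod_right'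
  have hpow : Measurable fun r : ℝ => ENNReal.ofReal (r ^ d) := by fun_prop
  calc ∫⁻ x, g x = ∫⁻ x in ({0}ᶜ : Set (Cn n)), g x := by rw [restrict_compl_singleton]
    _ = ∫⁻ x : ↥({0}ᶜ : Set (Cn n)), g (x : Cn n) ∂(volume.comap Subtype.val) :=
      (lintegral_subtype_comap (measurableSet_singleton _).compl g).symm
    _ = ∫⁻ p : Metric.sphere (0 : Cn n) 1 × Set.Ioi (0 : ℝ), g ((p.2 : ℝ) • (p.1 : Cn n))
          ∂((volume : Measure (Cn n)).toSphere.prod (.volumeIoiPow d)) := by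
      refine Eq.trans ?_
        ((volume : Measure (Cn n)).measurePreserving_homeomorphUnitSphereProd.lintegral_comp
          (hg.comp hcont.measurable))
      refine lintegral_congr fun x => ?_
      congr 1
      have hx : ‖(x : Cn n)‖ ≠ 0 := norm_ne_zero_iff.2 x.2
      simp [homeomorphUnitSphereProd, smul_smul, hx]
    _ = ∫⁻ r : Set.Ioi (0 : ℝ), τ * ∫⁻ ζ, g ((r : ℝ) • (ζ : Cn n)) ∂(sphereMeasure n)
          ∂(Measure.volumeIoiPow d) := by
      refine (lintegral_prod_symm _ (hg.comp hcont.measurable).aemeasurable).trans ?_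
      refine lintegral_congr fun r => ?_
      rw [toSphere_eq_smul_sphereMeasure hn, Function.comp_def, lintegral_smul_measure, smul_eq_mul]
    _ = τ * ∫⁻ r : Set.Ioi (0 : ℝ), ∫⁻ ζ, g ((r : ℝ) • (ζ : Cn n)) ∂(sphereMeasure n)
          ∂(Measure.volumeIoiPow d) :=
      lintegral_const_mul' _ _ (measure_ne_top _ _)
    _ = _ := by
      congr 1
      refine (lintegral_withDensity_eq_lintegral_mul _
        (hpow.comp measurable_subtype_coe) (hG.comp measurable_subtype_coe)).trans ?_
      exact lintegral_subtype_comap measurableSet_Ioi fun r : ℝ => ENNReal.ofReal (r ^ d) *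
        ∫⁻ ζ, g (r • (ζ : Cn n)) ∂(sphereMeasure n)

/-- Integration of a function with a radial weight over the unit ball in polar coordinates. -/
theorem setLIntegral_unitBall_mul_radial {v : Cn n → ℝ≥0∞} {h : ℝ → ℝ≥0∞} (hn : 1 ≤ n)
    (hv : Measurable ((unitBall n).indicator v)) (hh : Measurable h) :
    ∫⁻ x in unitBall n, v x * h ‖x‖ = (volume : Measure (Cn n)).toSphere Set.univ *
      ∫⁻ r in Set.Ioo (0 : ℝ) 1, ENNReal.ofReal (r ^ (Module.finrank ℝ (Cn n) - 1)) * h r *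
        ∫⁻ ζ, v (r • (ζ : Cn n)) ∂(sphereMeasure n) := by
  have hB : MeasurableSet (unitBall n) := isOpen_unitBall.measurableSet
  have h1 : (unitBall n).indicator (fun x => v x * h ‖x‖)
      = fun x => (unitBall n).indicator v x * h ‖x‖ := by
    ext x
    by_cases hx : x ∈ unitBall n <;> simp [hx]
  rw [← lintegral_indicator hB, h1]
  refine (lintegral_eq_lintegral_sphere hn (hv.mul (hh.comp measurable_norm))).trans ?_
  simp only [Pi.mul_apply, Function.comp_apply]
  congr 1
  rw [← lintegral_indicator measurableSet_Ioi, ← lintegral_indicator measurableSet_Ioo]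
  refine lintegral_congr fun r => ?_
  by_cases hr : r ∈ Set.Ioi (0 : ℝ)
  · have hr0 : 0 < r := hr
    have hnorm : ∀ ζ : Metric.sphere (0 : Cn n) 1, ‖r • (ζ : Cn n)‖ = r := fun ζ => by
      rw [norm_smul, mem_sphere_zero_iff_norm.1 ζ.2, mul_one, Real.norm_of_nonneg hr0.le]
    have hcont : Continuous fun ζ : Metric.sphere (0 : Cn n) 1 => r • (ζ : Cn n) := by fun_prop
    rw [Set.indicator_of_mem hr]
    simp only [hnorm]
    by_cases hr1 : r < 1
    · have hmem : ∀ ζ : Metric.sphere (0 : Cn n) 1, r • (ζ : Cn n) ∈ unitBall n := fun ζ => by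
        rwa [mem_unitBall_iff, hnorm]
      rw [Set.indicator_of_mem (Set.mem_Ioo.2 ⟨hr0, hr1⟩),
        lintegral_mul_const _ (show Measurable fun ζ : Metric.sphere (0 : Cn n) 1 =>
          (unitBall n).indicator v (r • (ζ : Cn n)) from hv.comp hcont.measurable)]
      simp only [Set.indicator_of_mem (hmem _)]
      ring
    · have hmem : ∀ ζ : Metric.sphere (0 : Cn n) 1, r • (ζ : Cn n) ∉ unitBall n := fun ζ => by
        rwa [mem_unitBall_iff, hnorm]
      rw [Set.indicator_of_notMem (fun h : r ∈ Set.Ioo (0 : ℝ) 1 => hr1 h.2)]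
      simp only [Set.indicator_of_notMem (hmem _)]
      simp
  · rw [Set.indicator_of_notMem hr, Set.indicator_of_notMem fun h => hr h.1]

end Sphere
-- Monotonicity of spherical means.
section Mean

variable {n : ℕ} {f : Cn n → ℂ} {q : ℝ}

theorem smul_sphere_mem_unitBall {l : ℂ} (hl : ‖l‖ < 1) (ζ : Metric.sphere (0 : Cn n) 1) :
    l • (ζ : Cn n) ∈ unitBall n := by
  rwa [mem_unitBall_iff, norm_smul, mem_sphere_zero_iff_norm.1 ζ.2, mul_one]

theorem continuous_norm_rpow_smul (hf : DifferentiableOn ℂ f (unitBall n)) (hq : 0 < q)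
    {X : Type*} [TopologicalSpace X] {l : X → ℂ} (hl : Continuous l) (hl1 : ∀ x, ‖l x‖ < 1) :
    Continuous fun p : X × Metric.sphere (0 : Cn n) 1 => ‖f (l p.1 • (p.2 : Cn n))‖ ^ q := by
  have h : Continuous fun p : X × Metric.sphere (0 : Cn n) 1 => f (l p.1 • (p.2 : Cn n)) :=
    hf.continuousOn.comp_continuous (by fun_prop) fun p =>
      smul_sphere_mem_unitBall (hl1 p.1) p.2
  exact h.norm.rpow_const fun _ => Or.inr hq.le

/-- Links the real integrals needed for circle averages with the extended nonnegative integrals in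
the Hardy norm. -/
theorem ofReal_integral_norm_rpow_smul (hn : 1 ≤ n) (hf : DifferentiableOn ℂ f (unitBall n))
    (hq : 0 < q) {l : ℂ} (hl : ‖l‖ < 1) :
    ENNReal.ofReal (∫ ζ, ‖f (l • (ζ : Cn n))‖ ^ q ∂(sphereMeasure n))
      = ∫⁻ ζ, ‖f (l • (ζ : Cn n))‖ₑ ^ q ∂(sphereMeasure n) := by
  have := isFiniteMeasure_sphereMeasure hn
  have hcont : Continuous fun ζ : Metric.sphere (0 : Cn n) 1 => ‖f (l • (ζ : Cn n))‖ ^ q :=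
    (continuous_norm_rpow_smul hf hq (X := Unit) (l := fun _ => l) continuous_const
      fun _ => hl).comp (by fun_prop : Continuous fun ζ : Metric.sphere (0 : Cn n) 1 => ((), ζ))
  rw [ofReal_integral_eq_lintegral_ofReal
    (hcont.integrable_of_hasCompactSupport (HasCompactSupport.of_compactSpace _))
    (Filter.Eventually.of_forall fun ζ => by positivity)]
  refine lintegral_congr fun ζ => ?_
  rw [← ENNReal.ofReal_rpow_of_nonneg (norm_nonneg _) hq.le, ofReal_norm]

/-- Fubini reduces this to the one-variable inequality for each slice `l ↦ f (l • ζ)`. -/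
theorem integral_norm_rpow_smul_le_circleAverage (hn : 1 ≤ n)
    (hf : DifferentiableOn ℂ f (unitBall n)) (hq : 0 < q) {c : ℂ} {ρ : ℝ} (hρ : 0 < ρ)
    (hsub : Metric.closedBall c ρ ⊆ Metric.ball 0 1) :
    ∫ ζ, ‖f (c • (ζ : Cn n))‖ ^ q ∂(sphereMeasure n) ≤
      Real.circleAverage (fun l => ∫ ζ, ‖f (l • (ζ : Cn n))‖ ^ q ∂(sphereMeasure n)) c ρ := by
  have := isFiniteMeasure_sphereMeasure hn
  have hlt : ∀ θ, ‖circleMap c ρ θ‖ < 1 := fun θ =>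
    mem_ball_zero_iff.1 (hsub (circleMap_mem_closedBall c hρ.le θ))
  have hc : ‖c‖ < 1 := mem_ball_zero_iff.1 (hsub (Metric.mem_closedBall_self hρ.le))
  have hcont : Continuous fun p : ℝ × Metric.sphere (0 : Cn n) 1 =>
      ‖f (circleMap c ρ p.1 • (p.2 : Cn n))‖ ^ q :=
    continuous_norm_rpow_smul hf hq (continuous_circleMap c ρ) hlt
  have hcont0 : Continuous fun ζ : Metric.sphere (0 : Cn n) 1 => ‖f (c • (ζ : Cn n))‖ ^ q :=
    (continuous_norm_rpow_smul hf hq (X := Unit) (l := fun _ => c) continuous_const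
      fun _ => hc).comp (by fun_prop : Continuous fun ζ : Metric.sphere (0 : Cn n) 1 => ((), ζ))
  have hint : Integrable (fun p : ℝ × Metric.sphere (0 : Cn n) 1 =>
      ‖f (circleMap c ρ p.1 • (p.2 : Cn n))‖ ^ q)
      ((volume.restrict (Set.Ioc 0 (2 * Real.pi))).prod (sphereMeasure n)) := by
    rw [← Measure.restrict_univ (μ := sphereMeasure n), Measure.prod_restrict]
    exact (hcont.continuousOn.integrableOn_compact (isCompact_Icc.prod isCompact_univ)).mono_set
      (Set.prod_mono Set.Ioc_subset_Icc_self subset_rfl)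
  rw [Real.circleAverage_def, intervalIntegral.integral_of_le Real.two_pi_pos.le,
    integral_integral_swap hint, smul_eq_mul, ← integral_const_mul]
  refine integral_mono
    (hcont0.integrable_of_hasCompactSupport (HasCompactSupport.of_compactSpace _))
    (hint.integral_prod_right.const_mul _) fun ζ => ?_
  have hana : AnalyticOnNhd ℂ (fun l : ℂ => f (l • (ζ : Cn n))) (Metric.closedBall c ρ) := by
    refine AnalyticOnNhd.mono (DifferentiableOn.analyticOnNhd ?_ Metric.isOpen_ball) hsub
    exact hf.comp (by fun_prop) fun l hl =>
      smul_sphere_mem_unitBall (mem_ball_zero_iff.1 hl) ζ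
  have h := norm_rpow_le_circleAverage hρ hq hana
  rwa [Real.circleAverage_def, intervalIntegral.integral_of_le Real.two_pi_pos.le,
    smul_eq_mul] at h

/-- The integral means of a holomorphic function over the spheres of radius `r` increase
with `r`. -/
theorem lintegral_sphere_mono (hn : 1 ≤ n) (hf : DifferentiableOn ℂ f (unitBall n))
    (hq : 0 < q) {r R : ℝ} (hr : 0 ≤ r) (hrR : r ≤ R) (hR : R < 1) :
    ∫⁻ ζ, ‖f ((r : ℂ) • (ζ : Cn n))‖ₑ ^ q ∂(sphereMeasure n)
      ≤ ∫⁻ ζ, ‖f ((R : ℂ) • (ζ : Cn n))‖ₑ ^ q ∂(sphereMeasure n) := by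
  have := isFiniteMeasure_sphereMeasure hn
  rcases (hr.trans hrR).eq_or_lt with hR0 | hR0
  · rw [show r = R by linarith]
  let u : ℂ → ℝ := fun l => ∫ ζ, ‖f (l • (ζ : Cn n))‖ ^ q ∂(sphereMeasure n)
  have hu : ContinuousOn u (Metric.closedBall 0 R) := by
    rw [continuousOn_iff_continuous_domRestrict]
    have h := continuous_norm_rpow_smul hf hq (X := Metric.closedBall (0 : ℂ) R)
      (l := Subtype.val) continuous_subtype_val
      fun x => (mem_closedBall_zero_iff.1 x.2).trans_lt hR
    have h' := continuous_parametric_integral_of_continuous (μ := sphereMeasure n)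
      (f := fun (x : Metric.closedBall (0 : ℂ) R) (ζ : Metric.sphere (0 : Cn n) 1) =>
        ‖f ((x : ℂ) • (ζ : Cn n))‖ ^ q) h isCompact_univ
    simp only [Measure.restrict_univ] at h'
    exact h'
  obtain ⟨w, hw, hle⟩ := exists_mem_sphere_le_of_le_circleAverage hu
    (fun c ρ hρ hsub => integral_norm_rpow_smul_le_circleAverage hn hf hq hρ
      (hsub.trans (Metric.ball_subset_ball hR.le)))
    (z := (r : ℂ)) (by
      rwa [mem_closedBall_zero_iff, Complex.norm_real, Real.norm_of_nonneg hr])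
  rw [mem_sphere_zero_iff_norm] at hw
  have hRn : ‖(R : ℂ)‖ = R := by rw [Complex.norm_real, Real.norm_of_nonneg hR0.le]
  have hR0' : (R : ℂ) ≠ 0 := by exact_mod_cast hR0.ne'
  have hmeas : Measurable fun ζ : Metric.sphere (0 : Cn n) 1 =>
      ‖f ((R : ℂ) • (ζ : Cn n))‖ₑ ^ q := by
    have : Continuous fun ζ : Metric.sphere (0 : Cn n) 1 => f ((R : ℂ) • (ζ : Cn n)) :=
      hf.continuousOn.comp_continuous (by fun_prop) fun ζ =>
        smul_sphere_mem_unitBall (by rwa [hRn]) ζ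
    exact this.measurable.enorm.pow_const q
  rw [← ofReal_integral_norm_rpow_smul hn hf hq
    (by rw [Complex.norm_real, Real.norm_of_nonneg hr]; linarith)]
  -- The maximum principle only gives some `w` with `‖w‖ = R`. The rotation by `w / R` shows that
  -- the mean at `w` equals the mean at `R`.
  refine (ENNReal.ofReal_le_ofReal hle).trans ?_
  rw [ofReal_integral_norm_rpow_smul hn hf hq (by rwa [hw])]
  rw [← lintegral_sphereMeasure_smul (a := w / R) (by rw [norm_div, hw, hRn, div_self hR0.ne'])
    (g := fun x => ‖f ((R : ℂ) • x)‖ₑ ^ q) hmeas]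
  simp only [smul_smul, mul_div_cancel₀ _ hR0', le_refl]

end Mean
-- Estimates for the radial weight as `s → 0`.
section Weight

theorem setLIntegral_one_sub_rpow {a s : ℝ} (ha : a ≤ 1) (hs : 0 < s) :
    ∫⁻ r in Set.Ioo a 1, ENNReal.ofReal ((1 - r) ^ (s - 1))
      = ENNReal.ofReal ((1 - a) ^ s / s) := by
  have hint : IntervalIntegrable (fun r : ℝ => (1 - r) ^ (s - 1)) volume a 1 := by
    have := (intervalIntegral.intervalIntegrable_rpow' (a := 1 - a) (b := 0)
      (by linarith : -1 < s - 1)).comp_sub_left 1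
    simpa using this
  rw [setLIntegral_congr Ioo_ae_eq_Ioc, ← ofReal_integral_eq_lintegral_ofReal hint.1 ?_,
    ← intervalIntegral.integral_of_le ha,
    intervalIntegral.integral_comp_sub_left (fun r : ℝ => r ^ (s - 1)),
    integral_rpow (Or.inl (by linarith))]
  · simp [Real.zero_rpow hs.ne']
  · filter_upwards [ae_restrict_mem measurableSet_Ioc] with r hr
    exact Real.rpow_nonneg (by linarith [hr.2]) _

/-- The density in polar coordinates of the weight `(1 - |x|²) ^ (s - 1)`. -/
noncomputable def radialWeight (d : ℕ) (s r : ℝ) : ℝ≥0∞ :=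
  ENNReal.ofReal (r ^ d) * ENNReal.ofReal ((1 - r ^ 2) ^ (s - 1))

variable {d : ℕ} {s a : ℝ}

/-- Since `1 - r² ≥ 1 - r` and `s - 1 ≤ 0`, the weight is at most `(1 - r)^(s-1)`, which is
integrable. -/
theorem setLIntegral_radialWeight_lt_top (ha : 0 ≤ a) (ha1 : a < 1) (hs : 0 < s) (hs1 : s ≤ 1) :
    ∫⁻ r in Set.Ioo a 1, radialWeight d s r < ∞ := by
  refine lt_of_le_of_lt ?_ (ENNReal.ofReal_lt_top (r := (1 - a) ^ s / s))
  rw [← setLIntegral_one_sub_rpow ha1.le hs]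
  refine setLIntegral_mono' measurableSet_Ioo fun r hr => ?_
  have hr0 : 0 ≤ r := ha.trans hr.1.le
  have h1 : ENNReal.ofReal (r ^ d) ≤ 1 := by
    rw [ENNReal.ofReal_le_one]; exact pow_le_one₀ hr0 hr.2.le
  refine (mul_le_mul_left h1 _).trans ?_
  rw [one_mul]
  refine ENNReal.ofReal_le_ofReal ?_
  exact Real.rpow_le_rpow_of_nonpos (by linarith [hr.2]) (by nlinarith [hr.2]) (by linarith)

/-- From `1 - r² ≤ 2 (1 - r)` and `2^(s-1) ≥ 1/2`. For `a > 0` the factor `1 / s` forces the mass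
near the boundary to infinity as `s → 0`. -/
theorem le_setLIntegral_radialWeight (ha : 0 ≤ a) (ha1 : a < 1) (hs : 0 < s) (hs1 : s ≤ 1) :
    ENNReal.ofReal (a ^ d / 2 * (1 - a) / s) ≤ ∫⁻ r in Set.Ioo a 1, radialWeight d s r := by
  calc ENNReal.ofReal (a ^ d / 2 * (1 - a) / s)
      ≤ ENNReal.ofReal (a ^ d / 2 * ((1 - a) ^ s / s)) := by
        refine ENNReal.ofReal_le_ofReal ?_
        rw [mul_div_assoc]
        have : 1 - a ≤ (1 - a) ^ s := by
          conv_lhs => rw [← Real.rpow_one (1 - a)]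
          exact Real.rpow_le_rpow_of_exponent_ge (by linarith) (by linarith) hs1
        gcongr
    _ = ENNReal.ofReal (a ^ d / 2) * ∫⁻ r in Set.Ioo a 1, ENNReal.ofReal ((1 - r) ^ (s - 1)) := by
        rw [setLIntegral_one_sub_rpow ha1.le hs, ENNReal.ofReal_mul (by positivity)]
    _ = ∫⁻ r in Set.Ioo a 1, ENNReal.ofReal (a ^ d / 2) * ENNReal.ofReal ((1 - r) ^ (s - 1)) :=
        (lintegral_const_mul' _ _ ENNReal.ofReal_ne_top).symm
    _ ≤ _ := by
        refine setLIntegral_mono' measurableSet_Ioo fun r hr => ?_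
        have hr0 : 0 ≤ r := ha.trans hr.1.le
        have h1r : 0 < 1 - r := by linarith [hr.2]
        have h1 : (2 * (1 - r)) ^ (s - 1) ≤ (1 - r ^ 2) ^ (s - 1) :=
          Real.rpow_le_rpow_of_nonpos (by nlinarith [hr.2]) (by nlinarith [sq_nonneg (1 - r)])
            (by linarith)
        have h2 : (1 : ℝ) / 2 ≤ 2 ^ (s - 1) := by
          have : (1 : ℝ) / 2 = 2 ^ (-1 : ℝ) := by rw [Real.rpow_neg_one]; norm_num
          rw [this]
          exact Real.rpow_le_rpow_of_exponent_le (by norm_num) (by linarith)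
        rw [Real.mul_rpow (by norm_num) h1r.le] at h1
        have h3 : (1 : ℝ) / 2 * (1 - r) ^ (s - 1) ≤ (1 - r ^ 2) ^ (s - 1) :=
          (mul_le_mul_of_nonneg_right h2 (Real.rpow_nonneg h1r.le _)).trans h1
        rw [radialWeight, ← ENNReal.ofReal_mul (by positivity), ← ENNReal.ofReal_mul (by positivity)]
        refine ENNReal.ofReal_le_ofReal ?_
        have h4 : a ^ d ≤ r ^ d := pow_le_pow_left₀ ha hr.1.le d
        calc a ^ d / 2 * (1 - r) ^ (s - 1) = a ^ d * (1 / 2 * (1 - r) ^ (s - 1)) := by ring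
          _ ≤ r ^ d * (1 - r ^ 2) ^ (s - 1) := by gcongr

/-- On `(0, a]` the weight is at most `(1 - a²)⁻¹`, independently of `s`, so the inner part becomes
negligible in the limit. -/
theorem setLIntegral_radialWeight_le_add (ha : 0 ≤ a) (ha1 : a < 1) (hs : 0 < s) (hs1 : s ≤ 1) :
    ∫⁻ r in Set.Ioo 0 1, radialWeight d s r
      ≤ ENNReal.ofReal (1 - a ^ 2)⁻¹ + ∫⁻ r in Set.Ioo a 1, radialWeight d s r := by
  have ha2 : 0 < 1 - a ^ 2 := by nlinarith
  have hsub : Set.Ioo (0 : ℝ) 1 ⊆ Set.Ioc 0 a ∪ Set.Ioo a 1 := fun r hr =>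
    (le_or_gt r a).imp (fun h => ⟨hr.1, h⟩) fun h => ⟨h, hr.2⟩
  refine ((lintegral_mono_set hsub).trans (lintegral_union_le _ _ _)).trans ?_
  gcongr
  calc ∫⁻ r in Set.Ioc 0 a, radialWeight d s r
      ≤ ∫⁻ _ in Set.Ioc 0 a, ENNReal.ofReal (1 - a ^ 2)⁻¹ := by
        refine setLIntegral_mono' measurableSet_Ioc fun r hr => ?_
        have h1 : ENNReal.ofReal (r ^ d) ≤ 1 := by
          rw [ENNReal.ofReal_le_one]; exact pow_le_one₀ hr.1.le (hr.2.trans ha1.le)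
        refine (mul_le_mul_left h1 _).trans ?_
        rw [one_mul]
        refine ENNReal.ofReal_le_ofReal ?_
        have hra : r ^ 2 ≤ a ^ 2 := pow_le_pow_left₀ hr.1.le hr.2 2
        calc (1 - r ^ 2) ^ (s - 1) ≤ (1 - a ^ 2) ^ (s - 1) :=
              Real.rpow_le_rpow_of_nonpos ha2 (by linarith) (by linarith)
          _ ≤ (1 - a ^ 2) ^ (-1 : ℝ) :=
              Real.rpow_le_rpow_of_exponent_ge ha2 (by nlinarith) (by linarith)
          _ = _ := Real.rpow_neg_one _
    _ = ENNReal.ofReal (1 - a ^ 2)⁻¹ * ENNReal.ofReal a := by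
        rw [setLIntegral_const, Real.volume_Ioc, sub_zero]
    _ ≤ ENNReal.ofReal (1 - a ^ 2)⁻¹ :=
        mul_le_of_le_one_right' (ENNReal.ofReal_le_one.2 ha1.le)

end Weight

/-! ### Comparison of Hardy means through weighted Bergman integrals. -/

section Isometry

variable {n : ℕ} {f g : Cn n → ℂ} {q : ℝ}

/-- Nothing is known about `f` outside the ball, so only the indicator is measurable. -/
theorem measurable_indicator_enorm_rpow (hf : DifferentiableOn ℂ f (unitBall n)) (hq : 0 < q) :
    Measurable ((unitBall n).indicator fun x => ‖f x‖ₑ ^ q) := by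
  classical
  have h : Measurable ((unitBall n).piecewise f 0) :=
    hf.continuousOn.measurable_piecewise continuousOn_const isOpen_unitBall.measurableSet
  convert! h.enorm.pow_const q using 1
  ext x
  by_cases hx : x ∈ unitBall n <;> simp [hx, hq]

theorem ofReal_smul_eq (r : ℝ) (x : Cn n) : (r : ℂ) • x = r • x := by
  ext i
  simp

/-- The weighted form of the isometry: comparing weighted Bergman integrals of `f` and of its
transform `g` under an automorphism bounds the spherical means of `g`. -/
theorem mul_lintegral_sphere_le (hn : 1 ≤ n) (hf : DifferentiableOn ℂ f (unitBall n))
    (hg : DifferentiableOn ℂ g (unitBall n)) (hq : 0 < q) {c : Cn n} (hc : c ∈ unitBall n)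
    (L : Cn n →ₗᵢ[ℂ] Cn n)
    (hfg : ∀ x ∈ unitBall n,
      ‖g x‖ₑ ^ q = ENNReal.ofReal (ballKernel c x ^ n) * ‖f (L (ballInvolution c x))‖ₑ ^ q)
    {N : ℝ≥0∞} (hN : ∀ r ∈ Set.Ico (0 : ℝ) 1,
      ∫⁻ ζ, ‖f ((r : ℂ) • (ζ : Cn n))‖ₑ ^ q ∂(sphereMeasure n) ≤ N)
    {a s : ℝ} (ha : 0 ≤ a) (hs : 0 < s) :
    ENNReal.ofReal (((1 - ‖c‖ ^ 2) / 4) ^ s) *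
      ((∫⁻ r in Set.Ioo a 1, radialWeight (Module.finrank ℝ (Cn n) - 1) s r) *
        ∫⁻ ζ, ‖g ((a : ℂ) • (ζ : Cn n))‖ₑ ^ q ∂(sphereMeasure n))
      ≤ (∫⁻ r in Set.Ioo 0 1, radialWeight (Module.finrank ℝ (Cn n) - 1) s r) * N := by
  set d := Module.finrank ℝ (Cn n) - 1
  set τ := (volume : Measure (Cn n)).toSphere Set.univ
  let h : ℝ → ℝ≥0∞ := fun r => ENNReal.ofReal ((1 - r ^ 2) ^ (s - 1))
  have hh : Measurable h := by fun_prop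
  have hκ : 0 < (1 - ‖c‖ ^ 2) / 4 := by
    rw [← ballDefect_sq hc]; have := ballDefect_pos hc; positivity
  have hw : Measurable (radialWeight d s) := by unfold radialWeight; fun_prop
  have hpolar : ∀ k : Cn n → ℂ, DifferentiableOn ℂ k (unitBall n) →
      ∫⁻ x in unitBall n, ‖k x‖ₑ ^ q * h ‖x‖ = τ * ∫⁻ r in Set.Ioo (0 : ℝ) 1,
        radialWeight d s r * ∫⁻ ζ, ‖k ((r : ℂ) • (ζ : Cn n))‖ₑ ^ q ∂(sphereMeasure n) :=
    fun k hk => by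
      rw [setLIntegral_unitBall_mul_radial hn (measurable_indicator_enorm_rpow hk hq) hh]
      simp only [ofReal_smul_eq, radialWeight, h, d, τ]
  -- The Jacobian `K^(n+1)` times the factor `K^(s-1)` from the weight is `K^s K^n`. The hypothesis
  -- `hfg` absorbs `K^n`, and `K^s` is bounded below by `le_ballKernel`.
  have hpoint : ∀ x ∈ unitBall n, ENNReal.ofReal (((1 - ‖c‖ ^ 2) / 4) ^ s) * (‖g x‖ₑ ^ q * h ‖x‖)
      ≤ ENNReal.ofReal (ballKernel c x ^ (n + 1)) *
        (‖f (L (ballInvolution c x))‖ₑ ^ q * h ‖L (ballInvolution c x)‖) := fun x hx => by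
    have hK := ballKernel_pos hc hx
    have hx1 : 0 < 1 - ‖x‖ ^ 2 := by
      have := mem_unitBall_iff.1 hx
      nlinarith [norm_nonneg x]
    have h1 : h ‖L (ballInvolution c x)‖
        = ENNReal.ofReal (ballKernel c x ^ (s - 1)) * h ‖x‖ := by
      simp only [h]
      rw [L.norm_map, one_sub_norm_ballInvolution_sq hc hx, Real.mul_rpow hK.le hx1.le,
        ENNReal.ofReal_mul (by positivity)]
    have h2 : ballKernel c x ^ (n + 1) * ballKernel c x ^ (s - 1)
        = ballKernel c x ^ s * ballKernel c x ^ n := by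
      rw [pow_succ, mul_assoc, ← Real.rpow_one_add' hK.le (by linarith), mul_comm]
      congr 2
      ring
    have h3 : ENNReal.ofReal (ballKernel c x ^ (n + 1)) * ENNReal.ofReal (ballKernel c x ^ (s - 1))
        = ENNReal.ofReal (ballKernel c x ^ s) * ENNReal.ofReal (ballKernel c x ^ n) := by
      rw [← ENNReal.ofReal_mul (by positivity), h2, ENNReal.ofReal_mul (by positivity)]
    calc ENNReal.ofReal (((1 - ‖c‖ ^ 2) / 4) ^ s) * (‖g x‖ₑ ^ q * h ‖x‖)
        ≤ ENNReal.ofReal (ballKernel c x ^ s) * (‖g x‖ₑ ^ q * h ‖x‖) := by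
          gcongr
          exact le_ballKernel hc hx
      _ = (ENNReal.ofReal (ballKernel c x ^ s) * ENNReal.ofReal (ballKernel c x ^ n)) *
          (‖f (L (ballInvolution c x))‖ₑ ^ q * h ‖x‖) := by rw [hfg x hx]; ring
      _ = _ := by rw [← h3, h1]; ring
  have hmain : ENNReal.ofReal (((1 - ‖c‖ ^ 2) / 4) ^ s) * (τ * ∫⁻ r in Set.Ioo (0 : ℝ) 1,
        radialWeight d s r * ∫⁻ ζ, ‖g ((r : ℂ) • (ζ : Cn n))‖ₑ ^ q ∂(sphereMeasure n))
      ≤ τ * ∫⁻ r in Set.Ioo (0 : ℝ) 1,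
        radialWeight d s r * ∫⁻ ζ, ‖f ((r : ℂ) • (ζ : Cn n))‖ₑ ^ q ∂(sphereMeasure n) := by
    rw [← hpolar g hg, ← hpolar f hf, ← lintegral_const_mul' _ _ ENNReal.ofReal_ne_top,
      ← setLIntegral_comp_ballInvolution hc L fun x => ‖f x‖ₑ ^ q * h ‖x‖]
    exact setLIntegral_mono' isOpen_unitBall.measurableSet hpoint
  rw [mul_left_comm, ENNReal.mul_le_mul_iff_right (toSphere_univ_ne_zero hn)
    (measure_ne_top _ _)] at hmain
  -- On the left only radii in `(a, 1)` are kept, where the means of `g` are at least the one at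
  -- `a`. On the right every mean of `f` is at most `N`.
  refine le_trans ?_ (hmain.trans ?_)
  · gcongr
    rw [← lintegral_mul_const _ hw]
    refine le_trans ?_ (lintegral_mono_set (Set.Ioo_subset_Ioo_left ha))
    refine setLIntegral_mono' measurableSet_Ioo fun r hr => ?_
    refine mul_le_mul' le_rfl ?_
    exact lintegral_sphere_mono hn hg hq ha hr.1.le hr.2
  · rw [← lintegral_mul_const _ hw]
    refine setLIntegral_mono' measurableSet_Ioo fun r hr => ?_
    gcongr
    exact hN r ⟨hr.1.le, hr.2⟩

/-- The transform `g` of `f` under an automorphism of the ball has spherical means bounded by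
those of `f`. -/
theorem lintegral_sphere_le_of_eq_ballKernel_mul (hn : 1 ≤ n)
    (hf : DifferentiableOn ℂ f (unitBall n))
    (hg : DifferentiableOn ℂ g (unitBall n)) (hq : 0 < q) {c : Cn n} (hc : c ∈ unitBall n)
    (L : Cn n →ₗᵢ[ℂ] Cn n)
    (hfg : ∀ x ∈ unitBall n,
      ‖g x‖ₑ ^ q = ENNReal.ofReal (ballKernel c x ^ n) * ‖f (L (ballInvolution c x))‖ₑ ^ q)
    {N : ℝ≥0∞} (hN : ∀ r ∈ Set.Ico (0 : ℝ) 1,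
      ∫⁻ ζ, ‖f ((r : ℂ) • (ζ : Cn n))‖ₑ ^ q ∂(sphereMeasure n) ≤ N)
    {a : ℝ} (ha : a ∈ Set.Ico (0 : ℝ) 1) :
    ∫⁻ ζ, ‖g ((a : ℂ) • (ζ : Cn n))‖ₑ ^ q ∂(sphereMeasure n) ≤ N := by
  -- The lower bound for the mass on `(a, 1)` contains `a ^ d` and may degenerate at `a = 0`;
  -- monotonicity of the means allows a larger radius.
  wlog ha0 : 0 < a generalizing a
  · have h1 : a ≤ (1 + a) / 2 := by linarith [ha.2]
    have h2 : (1 + a) / 2 < 1 := by linarith [ha.2]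
    have h3 : 0 < (1 + a) / 2 := by linarith [ha.1]
    exact (lintegral_sphere_mono hn hg hq ha.1 h1 h2).trans (this ⟨h3.le, h2⟩ h3)
  set d := Module.finrank ℝ (Cn n) - 1
  have ha1 : 0 < 1 - a := by linarith [ha.2]
  set M := ∫⁻ ζ, ‖g ((a : ℂ) • (ζ : Cn n))‖ₑ ^ q ∂(sphereMeasure n)
  set κ := (1 - ‖c‖ ^ 2) / 4 with hκdef
  have hκ : 0 < κ := by
    rw [hκdef, ← ballDefect_sq hc]; have := ballDefect_pos hc; positivity
  let T : ℝ → ℝ≥0∞ := fun s => ∫⁻ r in Set.Ioo a 1, radialWeight d s r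
  set H := ENNReal.ofReal (1 - a ^ 2)⁻¹
  -- The weighted estimate divided by the mass `T s`. As `s → 0+`, `κ ^ s → 1` and `H / T s → 0`,
  -- which leaves `M ≤ N`.
  have hbound : ∀ᶠ s in nhdsWithin (0 : ℝ) (Set.Ioi 0),
      ENNReal.ofReal (κ ^ s) * M ≤ (H / T s + 1) * N := by
    filter_upwards [Ioc_mem_nhdsGT one_pos] with s hs
    have hT0 : T s ≠ 0 := by
      refine ne_of_gt (lt_of_lt_of_le ?_ (le_setLIntegral_radialWeight ha.1 ha.2 hs.1 hs.2))
      have := hs.1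
      rw [ENNReal.ofReal_pos]
      positivity
    have hT1 : T s ≠ ∞ := (setLIntegral_radialWeight_lt_top ha.1 ha.2 hs.1 hs.2).ne
    have h1 := mul_lintegral_sphere_le hn hf hg hq hc L hfg hN ha.1 hs.1
    have h2 : T s * (ENNReal.ofReal (κ ^ s) * M) ≤ T s * ((H / T s + 1) * N) := by
      calc T s * (ENNReal.ofReal (κ ^ s) * M) = ENNReal.ofReal (κ ^ s) * (T s * M) := by ring
        _ ≤ _ := h1
        _ ≤ (H + T s) * N := by
          gcongr
          exact setLIntegral_radialWeight_le_add ha.1 ha.2 hs.1 hs.2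
        _ = T s * ((H / T s + 1) * N) := by
          rw [← mul_assoc, mul_add, mul_one, ENNReal.mul_div_cancel hT0 hT1]
    exact (ENNReal.mul_le_mul_iff_right hT0 hT1).1 h2
  have hTlim : Filter.Tendsto T (nhdsWithin (0 : ℝ) (Set.Ioi 0)) (nhds ∞) := by
    have h1 : Filter.Tendsto (fun s : ℝ => ENNReal.ofReal (a ^ d / 2 * (1 - a) / s))
        (nhdsWithin (0 : ℝ) (Set.Ioi 0)) (nhds ∞) := by
      refine ENNReal.tendsto_ofReal_atTop.comp ?_
      exact Filter.Tendsto.const_mul_atTop (by positivity) tendsto_inv_nhdsGT_zero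
    refine tendsto_of_tendsto_of_tendsto_of_le_of_le' h1 tendsto_const_nhds ?_
      (Filter.Eventually.of_forall fun _ => le_top)
    filter_upwards [Ioc_mem_nhdsGT one_pos] with s hs
    exact le_setLIntegral_radialWeight ha.1 ha.2 hs.1 hs.2
  have hleft : Filter.Tendsto (fun s => ENNReal.ofReal (κ ^ s) * M)
      (nhdsWithin (0 : ℝ) (Set.Ioi 0)) (nhds M) := by
    have h1 : Filter.Tendsto (fun s : ℝ => ENNReal.ofReal (κ ^ s))
        (nhdsWithin (0 : ℝ) (Set.Ioi 0)) (nhds 1) := by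
      have : Filter.Tendsto (fun s : ℝ => ENNReal.ofReal (κ ^ s)) (nhds 0)
          (nhds (ENNReal.ofReal (κ ^ (0 : ℝ)))) :=
        (ENNReal.continuous_ofReal.comp (Real.continuous_const_rpow hκ.ne')).tendsto 0
      rw [Real.rpow_zero, ENNReal.ofReal_one] at this
      exact this.mono_left nhdsWithin_le_nhds
    have h2 := ENNReal.Tendsto.mul_const (b := M) h1 (Or.inl one_ne_zero)
    rwa [one_mul] at h2
  have hright : Filter.Tendsto (fun s => (H / T s + 1) * N)
      (nhdsWithin (0 : ℝ) (Set.Ioi 0)) (nhds N) := by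
    have h1 : Filter.Tendsto (fun s => H / T s + 1) (nhdsWithin (0 : ℝ) (Set.Ioi 0))
        (nhds (H / ∞ + 1)) :=
      (ENNReal.Tendsto.const_div hTlim (Or.inr ENNReal.ofReal_ne_top)).add tendsto_const_nhds
    rw [ENNReal.div_top, zero_add] at h1
    have h2 := ENNReal.Tendsto.mul_const (b := N) h1 (Or.inl one_ne_zero)
    rwa [one_mul] at h2
  exact le_of_tendsto_of_tendsto hleft hright hbound

end Isometry
-- The holomorphic multiplier.
section Transform

variable {n : ℕ} {c z : Cn n} {q : ℝ}

/-- The holomorphic function on the unit ball with `|ballFactor c q z| ^ q = ballKernel c z ^ n`. -/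
noncomputable def ballFactor (c : Cn n) (q : ℝ) (z : Cn n) : ℂ :=
  (((1 - ‖c‖ ^ 2) ^ (n / q) : ℝ) : ℂ) * (1 - inner ℂ c z) ^ ((-(2 * n / q) : ℝ) : ℂ)

/-- The base `1 - ⟨z, c⟩` has positive real part on the ball, so the principal branch of the power
is holomorphic there. -/
theorem differentiableOn_ballFactor (hc : c ∈ unitBall n) :
    DifferentiableOn ℂ (ballFactor c q) (unitBall n) := by
  have h : DifferentiableOn ℂ (fun z : Cn n => 1 - inner ℂ c z) (unitBall n) :=
    ((innerSL ℂ c).differentiable.const_sub 1).differentiableOn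
  exact (h.cpow_const fun z hz => Or.inl (one_sub_inner_re_pos hc hz)).const_mul _

theorem enorm_ballFactor_rpow (hc : c ∈ unitBall n) (hz : z ∈ unitBall n) (hq : 0 < q) :
    ‖ballFactor c q z‖ₑ ^ q = ENNReal.ofReal (ballKernel c z ^ n) := by
  have h1 : 0 < 1 - ‖c‖ ^ 2 := by
    rw [← ballDefect_sq hc]; have := ballDefect_pos hc; positivity
  have h2 := norm_pos_iff.2 (one_sub_inner_ne_zero hc hz)
  rw [← ofReal_norm, ENNReal.ofReal_rpow_of_nonneg (norm_nonneg _) hq.le, ballFactor, norm_mul,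
    Complex.norm_real, Real.norm_of_nonneg (by positivity), Complex.norm_cpow_real,
    Real.mul_rpow (by positivity) (by positivity), ← Real.rpow_mul h1.le, ← Real.rpow_mul h2.le,
    div_mul_cancel₀ _ hq.ne', neg_mul, div_mul_cancel₀ _ hq.ne', Real.rpow_natCast,
    Real.rpow_neg h2.le, ballKernel, div_pow, ← pow_mul]
  have h3 : ‖(1 - inner ℂ c z : ℂ)‖ ^ (2 * n : ℝ) = ‖(1 - inner ℂ c z : ℂ)‖ ^ (2 * n) := by
    rw [← Real.rpow_natCast]; push_cast; rfl
  rw [h3, div_eq_mul_inv]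

theorem ballFactor_ne_zero (hc : c ∈ unitBall n) (hz : z ∈ unitBall n) (hq : 0 < q) :
    ballFactor c q z ≠ 0 := fun h => by
  have h1 := enorm_ballFactor_rpow hc hz hq
  have h2 := ballKernel_pos hc hz
  rw [h, enorm_zero, ENNReal.zero_rpow_of_pos hq, eq_comm, ENNReal.ofReal_eq_zero] at h1
  exact absurd h1 (not_le.2 (by positivity))

end Transform

/-! ### Transfer of the interpolation problem. -/

theorem mainTheorem6 (n : ℕ) (hn : 1 ≤ n) (p : ℝ≥0∞) (hp : 0 < p)
    (a : ℕ → Cn n) (C : ℝ≥0) (hS : IsHardyInterpolating n p a C)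
    (Φ : Cn n → Cn n) (hΦ : IsBallAutomorphism n Φ) :
    IsHardyInterpolating n p (fun k => Φ (a k)) C := by
  obtain ⟨hΦd, hΦm, Ψ, hΨd, hΨm, hinv⟩ := hΦ
  obtain ⟨haB, hint⟩ := hS
  have hbB : ∀ k, Φ (a k) ∈ unitBall n := fun k => hΦm (haB k)
  refine ⟨hbB, fun lam hlam => ?_⟩
  by_cases hp' : p = ∞
  · have hseq : seqNorm n p a lam = seqNorm n p (fun k => Φ (a k)) lam := by
      simp only [seqNorm, if_pos hp']
    obtain ⟨f, ⟨hfd, hff⟩, hfa, hfC⟩ := hint lam (hseq ▸ hlam)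
    have hle : hardyNorm n p (f ∘ Ψ) ≤ hardyNorm n p f := by
      simp only [hardyNorm, if_pos hp']
      exact iSup₂_le fun z hz => le_iSup₂ (f := fun z (_ : z ∈ unitBall n) => ‖f z‖ₑ) _ (hΨm hz)
    refine ⟨f ∘ Ψ, ⟨hfd.comp hΨd hΨm, hle.trans_lt hff⟩, fun k => ?_, ?_⟩
    · rw [Function.comp_apply, hinv.1 (haB k), hfa]
    · rw [← hseq]
      exact hle.trans hfC
  have hq : 0 < p.toReal := ENNReal.toReal_pos hp.ne' hp'
  obtain ⟨L, hL⟩ := exists_linearIsometry_comp_ballInvolution hΦd hΦm hΨd hΨm hinv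
  set c := Φ 0
  set q := p.toReal
  have hc : c ∈ unitBall n := hΦm zero_mem_unitBall
  -- Data for the problem on `S`, chosen so that multiplying by the factor at `Φ (a k)` returns `lam
  -- k`.
  let mu : ℕ → ℂ := fun k => lam k / ballFactor c q (Φ (a k))
  have hmu : ∀ k, mu k * ballFactor c q (Φ (a k)) = lam k := fun k =>
    div_mul_cancel₀ _ (ballFactor_ne_zero hc (hbB k) hq)
  have hseq : seqNorm n p a mu = seqNorm n p (fun k => Φ (a k)) lam := by
    simp only [seqNorm, if_neg hp']
    congr 1
    refine tsum_congr fun k => ?_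
    have hK := ballKernel_pos hc (hbB k)
    -- Since `a k = Ψ (Φ (a k))` and `L` is isometric, this is the identity for the involution at `Φ
    -- (a k)`. The power `K^n` it yields cancels the one from the factor.
    have h1 : 1 - ‖a k‖ ^ 2 = ballKernel c (Φ (a k)) * (1 - ‖Φ (a k)‖ ^ 2) := by
      rw [← one_sub_norm_ballInvolution_sq hc (hbB k), ← L.norm_map (ballInvolution _ _), ← hL _ (hbB k),
        hinv.1 (haB k)]
    rw [← hmu k, enorm_mul, ENNReal.mul_rpow_of_nonneg _ _ hq.le,
      enorm_ballFactor_rpow hc (hbB k) hq, h1, mul_pow, ENNReal.ofReal_mul (by positivity),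
      mul_assoc]
  obtain ⟨f, ⟨hfd, hff⟩, hfa, hfC⟩ := hint mu (hseq ▸ hlam)
  let g : Cn n → ℂ := fun z => f (Ψ z) * ballFactor c q z
  have hgd : DifferentiableOn ℂ g (unitBall n) :=
    (hfd.comp hΨd hΨm).mul (differentiableOn_ballFactor hc)
  have hle : hardyNorm n p g ≤ hardyNorm n p f := by
    simp only [hardyNorm, if_neg hp']
    refine ENNReal.rpow_le_rpow (iSup₂_le fun r hr => ?_) (by positivity)
    refine lintegral_sphere_le_of_eq_ballKernel_mul hn hfd hgd hq hc L (fun x hx => ?_)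
      (fun t ht => le_iSup₂ (f := fun t (_ : t ∈ Set.Ico (0 : ℝ) 1) =>
        ∫⁻ ζ, ‖f ((t : ℂ) • (ζ : Cn n))‖ₑ ^ q ∂(sphereMeasure n)) t ht) hr
    simp only [g]
    rw [enorm_mul, ENNReal.mul_rpow_of_nonneg _ _ hq.le, enorm_ballFactor_rpow hc hx hq,
      hL x hx, mul_comm]
  refine ⟨g, ⟨hgd, hle.trans_lt hff⟩, fun k => ?_, ?_⟩
  · simp only [g]
    rw [hinv.1 (haB k), hfa, hmu]
  · rw [← hseq]
    exact hle.trans hfC
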